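/- Let $\pi$ be a probability distribution on $\mathbb{R}$ without atoms, and let $M\ge 1$. For each $n$ there are $M$ independent sequences $Y^{(1)},\dots,Y^{(M)}$ of $n$ real samples each; in one of them (the outlier, with unknown index $i$) the samples are i.i.d. with law $\mu$, in all others they are i.i.d. with law $\pi$. Write $\mathbb{P}_i$ for the joint law when $i$ is the outlier. Let $\ell_n\in\mathbb{N}$ and $T_n=\lfloor n/\ell_n\rfloor$ satisfy $\ell_n\to\infty$ and $T_n\to\infty$ as $n\to\infty$. For a sample $Y\in\mathbb{R}^n$ with order statistics $Y_{(1)}\le\dots\le Y_{(n)}$, let $I^n_1,\dots,I^n_{T_n}$ be the segments $(-\infty,Y_{(\ell_n)}],(Y_{(\ell_n)},Y_{(2\ell_n)}],\dots,(Y_{(\ell_n(T_n-1))},\infty)$, let $\epsilon_n=n-\ell_n(T_n-1)$, and put $$\hat D_n(Y\|\pi)=\sum_{t=1}^{T_n-1}\frac{\ell_n}{n}\log\frac{\ell_n/n}{\pi(I^n_t)}+\frac{\epsilon_n}{n}\log\frac{\epsilon_n/n}{\pi(I^n_{T_n})}.$$ Let $\delta_{\mathrm{KL}}=\arg\max_{1\le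 j\le M}\hat D_n(Y^{(j)}\|\pi)$, with ties broken in any way. For every probability distribution $\mu\neq\pi$ on $\mathbb{R}$ that is absolutely continuous with respect to $\pi$ and satisfies $0<K_1\le \frac{d\mu}{d\pi}\le K_2$ $\pi$-almost everywhere, with constants $K_1,K_2$, the test $\delta_{\mathrm{KL}}$ (which does not depend on $\mu,K_1,K_2$) is exponentially consistent, i.e. its error exponent $$\alpha(\delta_{\mathrm{KL}},\pi,\mu)=\liminf_{n\to\infty}-\frac1n\log\max_{1\le i\le M}\mathbb{P}_i\{\delta_{\mathrm{KL}}\neq i\}$$ is positive, and moreover $$\alpha(\delta_{\mathrm{KL}},\pi,\mu)\ \ge\ \frac{1}{32}\left(\frac{K_1}{K_1+K_2}\right)^2 D(\mu\|\pi)^2,\qquad D(\mu\|\pi)=\int \log\frac{d\mu}{d\pi}\,d\mu .$$ -/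

import Mathlib

open MeasureTheory Filter
open scoped ENNReal

namespace OutlierDetection

noncomputable section

/-- The `k`-th order statistic `Y_(k)` of the sample `y`, for `1 ≤ k ≤ n`
(so `Y_(1)` is the smallest value). The value outside this range is irrelevant. -/
def orderStat {n : ℕ} (y : Fin n → ℝ) (k : ℕ) : ℝ :=
  if h : k - 1 < n then y (Tuple.sort y ⟨k - 1, h⟩) else 0

/-- The end points of the empirically equiprobable segments with `l` points each:
`-∞` for `t = 0`, `+∞` for `t = T = ⌊n / l⌋`, and `Y_(l t)` for `0 < t < T`. -/
def cutPoint {n : ℕ} (y : Fin n → ℝ) (l t : ℕ) : EReal :=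
  if t = 0 then ⊥ else if t = n / l then ⊤ else (orderStat y (l * t) : EReal)

/-- The `t`-th segment of the data-dependent partition of the real line, counted from `0`:
`(-∞, Y_(l)], (Y_(l), Y_(2l)], …, (Y_(l (T - 1)), ∞)`. -/
def sampleSegment {n : ℕ} (y : Fin n → ℝ) (l t : ℕ) : Set ℝ :=
  {x : ℝ | cutPoint y l t < (x : EReal) ∧ (x : EReal) ≤ cutPoint y l (t + 1)}

/-- The divergence estimator `D̂_n(y ‖ q)` based on the data-dependent partition into
`T = ⌊n / l⌋` segments; the last segment holds `n - l (T - 1)` points. -/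
def klEstimator {n : ℕ} (q : Measure ℝ) (l : ℕ) (y : Fin n → ℝ) : ℝ :=
  (∑ t ∈ Finset.range (n / l - 1),
      ((l : ℝ) / n) * Real.log (((l : ℝ) / n) / q.real (sampleSegment y l t)))
    + (((n - l * (n / l - 1) : ℕ) : ℝ) / n)
      * Real.log ((((n - l * (n / l - 1) : ℕ) : ℝ) / n) / q.real (sampleSegment y l (n / l - 1)))

/-- The bounded density ratio condition `0 < K₁ ≤ dμ/dπ ≤ K₂`. -/
structure BoundedDensityRatio (μ π : Measure ℝ) (K₁ K₂ : ℝ) : Prop where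
  pos : 0 < K₁
  absolutelyContinuous : μ ≪ π
  lower : ∀ᵐ x ∂π, ENNReal.ofReal K₁ ≤ μ.rnDeriv π x
  upper : ∀ᵐ x ∂π, μ.rnDeriv π x ≤ ENNReal.ofReal K₂

/-- The joint law of `M` independent sequences of `n` i.i.d. samples, when sequence `i` is the
outlier: its samples have law `μ`, all others have law `π`. -/
def jointLaw {M : ℕ} (n : ℕ) (μ π : Measure ℝ) (i : Fin M) : Measure (Fin M → Fin n → ℝ) :=
  Measure.pi fun j => Measure.pi fun _ : Fin n => if j = i then μ else π

/-- The maximum error probability of a decision rule. -/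
def maxError {M n : ℕ} (δ : (Fin M → Fin n → ℝ) → Fin M) (π μ : Measure ℝ) : ℝ≥0∞ :=
  ⨆ i : Fin M, jointLaw n μ π i {y | δ y ≠ i}

/-- The error exponent of a test (one decision rule for each sample size `n`): the lower limit of
`-(1/n) log e`, in the extended reals (it is `+∞` where the error probability vanishes). -/
def errorExponent {M : ℕ} (δ : (n : ℕ) → (Fin M → Fin n → ℝ) → Fin M) (π μ : Measure ℝ) : EReal :=
  liminf (fun n : ℕ => (-ENNReal.log (maxError (δ n) π μ)) / (n : EReal)) atTop

/-- A test is exponentially consistent at `(π, μ)` if its error exponent is positive. -/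
def ExponentiallyConsistent {M : ℕ} (δ : (n : ℕ) → (Fin M → Fin n → ℝ) → Fin M)
    (π μ : Measure ℝ) : Prop :=
  0 < errorExponent δ π μ

/-- `δ` is the KL divergence test for the known typical law `π` and segment sizes `l n`: it picks
a sequence with the largest estimated divergence from `π`. Ties may be broken in any way. -/
def IsKLTest {M : ℕ} (π : Measure ℝ) (l : ℕ → ℕ)
    (δ : (n : ℕ) → (Fin M → Fin n → ℝ) → Fin M) : Prop :=
  ∀ (n : ℕ) (y : Fin M → Fin n → ℝ) (j : Fin M),
    klEstimator π (l n) (y j) ≤ klEstimator π (l n) (y (δ n y))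

end

end OutlierDetection

namespace OutlierDetection

/-! Write `D` for `D(μ‖π)` and `L = log K₂ - log K₁`, and compare every estimate with the threshold
`D / 2`. An error forces either a typical sequence to reach the threshold or the outlier to stay at
or below it; a union bound over the sequences (`maxError_le`) reduces the theorem to two tail bounds
for one sequence.

Under `π` the difficulty is that the partition depends on the data. It is determined by the few
samples that serve as end points. Given which indices these are and their values, the other samples
are still i.i.d. with law `π`, and the histogram with the prescribed cell masses is a (sub)density.
Its product over the other samples has expectation at most 1 (`lintegral_prod_histogram_le`), while
its logarithm is essentially `n` times the estimator (`sum_log_compl_endpoints_ge`). Markov's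
inequality and a sum over all possible index sets give exponent arbitrarily close to `D / 2`, since
the number of these sets is subexponential (`measure_le_klEstimator_le`, `choose_le_exp`).

Under `μ` a Donsker–Varadhan bound is used: for a continuous compactly supported `G` close to `log
dμ/dπ`, the estimator is at least the empirical mean of `G`, minus `∫ exp G dπ - 1` and small
discretization errors (`klEstimator_ge`). Hoeffding's inequality for that mean gives exponent `D² /
(8 L²)`.

Finally `K₁ / (K₁ + K₂) * L < 1` and `D ≤ L` put the claimed constant strictly below both exponents.
-/

/-! ### Cells cut out by sample points, and the counts in them. -/

/-- The number of the points `y i`, `i ∈ E`, that lie strictly below `x`: the index of the cell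
containing `x` in the partition of the real line with end points `y i`. -/
noncomputable def cellIndex {ι : Type*} (E : Finset ι) (y : ι → ℝ) (x : ℝ) : ℕ :=
  (E.filter fun i => y i < x).card

/-- The number of sample points in segment `t`. -/
def segmentCount (n l t : ℕ) : ℕ := if t < n / l - 1 then l else n - l * (n / l - 1)

theorem cellIndex_mono {ι : Type*} (E : Finset ι) (y : ι → ℝ) : Monotone (cellIndex E y) := by
  intro a b hab
  apply Finset.card_le_card
  intro i hi
  simp only [Finset.mem_filter] at hi ⊢
  exact ⟨hi.1, hi.2.trans_le hab⟩

theorem cellIndex_le {ι : Type*} (E : Finset ι) (y : ι → ℝ) (x : ℝ) : cellIndex E y x ≤ E.card :=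
  Finset.card_filter_le _ _

theorem measurable_cellIndex {ι : Type*} (E : Finset ι) (y : ι → ℝ) :
    Measurable (cellIndex E y) :=
  (cellIndex_mono E y).measurable

/-- A downward closed subset of `range m` is an initial segment, so its size is the first index
where `P` fails. -/
theorem card_filter_range_eq_iff {P : ℕ → Prop} [DecidablePred P] {m : ℕ}
    (hP : ∀ s < m, ∀ r ≤ s, P s → P r) {t : ℕ} (ht : t ≤ m) :
    ((Finset.range m).filter P).card = t ↔ (∀ s < t, P s) ∧ (t < m → ¬ P t) := by
  constructor
  · intro h
    have key : (Finset.range m).filter P = Finset.range t := by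
      have hsub : ∀ s ∈ (Finset.range m).filter P,
          Finset.range (s + 1) ⊆ (Finset.range m).filter P := by
        intro s hs r hr
        simp only [Finset.mem_filter, Finset.mem_range] at hs hr ⊢
        exact ⟨by omega, hP s hs.1 r (by omega) hs.2⟩
      apply Finset.eq_of_subset_of_card_le
      · intro s hs
        have := Finset.card_le_card (hsub s hs)
        simp only [Finset.card_range, Finset.mem_range] at this ⊢
        omega
      · simp [h]
    refine ⟨fun s hs => ?_, fun htm hPt => ?_⟩
    · have : s ∈ (Finset.range m).filter P := by rw [key]; simpa using hs
      exact (Finset.mem_filter.1 this).2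
    · have : t ∈ (Finset.range m).filter P := by simp [htm, hPt]
      rw [key] at this
      simp at this
  · rintro ⟨h1, h2⟩
    have key : (Finset.range m).filter P = Finset.range t := by
      ext s
      simp only [Finset.mem_filter, Finset.mem_range]
      refine ⟨fun ⟨hs, hPs⟩ => ?_, fun hs => ⟨by omega, h1 s hs⟩⟩
      by_contra hts
      exact h2 (by omega) (hP s hs t (by omega) hPs)
    rw [key, Finset.card_range]

/-- The indices of the sample points that are end points of segments. -/
noncomputable def endpoints {n : ℕ} (y : Fin n → ℝ) (l : ℕ) : Finset (Fin n) :=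
  (Finset.univ.filter fun k : Fin n => ∃ s < n / l - 1, (k : ℕ) + 1 = l * (s + 1)).map
    (Tuple.sort y).toEmbedding

theorem strictMono_comp_sort {n : ℕ} {y : Fin n → ℝ} (hy : Function.Injective y) :
    StrictMono (y ∘ Tuple.sort y) :=
  (Tuple.monotone_sort y).strictMono_of_injective (hy.comp (Tuple.sort y).injective)

theorem mul_succ_le_of_lt {n l s : ℕ} (hs : s < n / l - 1) : l * (s + 1) + l ≤ n := by
  have h := Nat.mul_div_le n l
  have : l * (s + 2) ≤ l * (n / l) := Nat.mul_le_mul_left _ (by omega)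
  nlinarith

section
variable {n : ℕ} {y : Fin n → ℝ} {l : ℕ}

/-- Sums over the end points are sums over the segments but the last. -/
theorem exists_endpoints_eq (y : Fin n → ℝ) (hl : 0 < l) (hn : 0 < n) :
    ∃ k : ℕ → Fin n, (∀ s < n / l - 1, (k s : ℕ) + 1 = l * (s + 1)) ∧
      Set.InjOn (fun s => Tuple.sort y (k s)) (Finset.range (n / l - 1)) ∧
      endpoints y l = (Finset.range (n / l - 1)).image fun s => Tuple.sort y (k s) := by
  have hlt : ∀ s < n / l - 1, l * (s + 1) - 1 < n := by
    intro s hs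
    have := mul_succ_le_of_lt hs
    omega
  have hpos : ∀ s, 0 < l * (s + 1) := fun s => by positivity
  set k : ℕ → Fin n := fun s => if h : s < n / l - 1 then ⟨l * (s + 1) - 1, hlt s h⟩ else ⟨0, hn⟩
    with hk
  have hk1 : ∀ s < n / l - 1, (k s : ℕ) + 1 = l * (s + 1) := by
    intro s hs
    have := hpos s
    simp only [hk, hs, dif_pos]
    omega
  refine ⟨k, hk1, ?_, ?_⟩
  · intro s hs r hr h
    have h' : k s = k r := (Tuple.sort y).injective h
    have h1 := hk1 s (by simpa using hs)
    have h2 := hk1 r (by simpa using hr)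
    rw [h', h2] at h1
    have := Nat.eq_of_mul_eq_mul_left hl h1
    omega
  · ext i
    simp only [endpoints, Finset.mem_map, Finset.mem_filter, Finset.mem_univ, true_and,
      Equiv.coe_toEmbedding, Finset.mem_image, Finset.mem_range]
    constructor
    · rintro ⟨j, ⟨s, hs, hj⟩, rfl⟩
      refine ⟨s, hs, ?_⟩
      congr 1
      ext
      have := hk1 s hs
      omega
    · rintro ⟨s, hs, rfl⟩
      exact ⟨k s, ⟨s, hs, hk1 s hs⟩, rfl⟩

theorem card_endpoints (y : Fin n → ℝ) (hl : 0 < l) (hn : 0 < n) :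
    (endpoints y l).card = n / l - 1 := by
  obtain ⟨k, -, hinj, hE⟩ := exists_endpoints_eq y hl hn
  rw [hE, Finset.card_image_of_injOn hinj, Finset.card_range]

theorem cellIndex_endpoints_eq (y : Fin n → ℝ) (hl : 0 < l) (x : ℝ) :
    cellIndex (endpoints y l) y x
      = ((Finset.range (n / l - 1)).filter fun s => orderStat y (l * (s + 1)) < x).card := by
  rcases Nat.eq_zero_or_pos n with rfl | hn
  · simp [cellIndex, endpoints]
  obtain ⟨k, hk, hinj, hE⟩ := exists_endpoints_eq y hl hn
  rw [cellIndex, hE, Finset.filter_image, Finset.card_image_of_injOn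
    (hinj.mono (Finset.coe_subset.2 (Finset.filter_subset _ _)))]
  congr 1
  apply Finset.filter_congr
  intro s hs
  have h := hk s (by simpa using hs)
  have h2 := (k s).2
  have : orderStat y (l * (s + 1)) = y (Tuple.sort y (k s)) := by
    rw [orderStat, dif_pos (by omega)]
    congr 2
    ext
    simp
    omega
  rw [this]

/-- In 0-based ranks the end points sit at `l * (s + 1) - 1`. Without ties, those strictly below
rank `k` are the ones with `s + 1 ≤ k / l`; the minimum reflects that the last cell absorbs the
remainder. -/
theorem cellIndex_sort (hy : Function.Injective y) (hl : 0 < l) (k : Fin n) :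
    cellIndex (endpoints y l) y (y (Tuple.sort y k)) = min ((k : ℕ) / l) (n / l - 1) := by
  rw [cellIndex_endpoints_eq y hl]
  have : (Finset.range (n / l - 1)).filter
      (fun s => orderStat y (l * (s + 1)) < y (Tuple.sort y k))
      = Finset.range (min ((k : ℕ) / l) (n / l - 1)) := by
    ext s
    simp only [Finset.mem_filter, Finset.mem_range, lt_min_iff]
    rw [and_comm]
    refine and_congr_left fun hs => ?_
    have h1 := mul_succ_le_of_lt hs
    have h2 : 0 < l * (s + 1) := by positivity
    rw [orderStat, dif_pos (by omega)]
    have := (strictMono_comp_sort hy).lt_iff_lt (a := ⟨l * (s + 1) - 1, by omega⟩) (b := k)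
    simp only [Function.comp] at this
    rw [this, Fin.lt_def, ← Nat.succ_le_iff (m := s), Nat.le_div_iff_mul_le hl, mul_comm _ l]
    simp only [Nat.succ_eq_add_one]
    omega
  rw [this, Finset.card_range]

theorem sampleSegment_eq (hl : 0 < l) {t : ℕ} (ht : t < n / l) :
    sampleSegment y l t = cellIndex (endpoints y l) y ⁻¹' {t} := by
  have horder : ∀ s < n / l - 1, ∀ r ≤ s, orderStat y (l * (r + 1)) ≤ orderStat y (l * (s + 1)) := by
    intro s hs r hr
    have h1 := mul_succ_le_of_lt hs
    have h3 : l * (r + 1) ≤ l * (s + 1) := Nat.mul_le_mul_left _ (by omega)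
    rw [orderStat, orderStat, dif_pos (by omega), dif_pos (by omega)]
    apply Tuple.monotone_sort y
    simp only [Fin.mk_le_mk]
    omega
  ext x
  rw [Set.mem_preimage, Set.mem_singleton_iff, cellIndex_endpoints_eq y hl,
    card_filter_range_eq_iff (fun s hs r hr h => (horder s hs r hr).trans_lt h) (by omega)]
  simp only [sampleSegment, cutPoint, Set.mem_ofPred_eq]
  apply and_congr
  · rcases Nat.eq_zero_or_pos t with rfl | htp
    · simp
    · rw [if_neg (by omega), if_neg (by omega), EReal.coe_lt_coe_iff]
      constructor
      · intro h s hs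
        refine lt_of_le_of_lt ?_ h
        have := horder (t - 1) (by omega) s (by omega)
        rwa [Nat.sub_add_cancel htp] at this
      · intro h
        have := h (t - 1) (by omega)
        rwa [Nat.sub_add_cancel htp] at this
  · rw [if_neg (by omega)]
    split_ifs with h
    · simp; omega
    · rw [EReal.coe_le_coe_iff]
      simp [show t < n / l - 1 by omega]

theorem card_filter_min_div (hl : 0 < l) {t : ℕ} (ht : t < n / l) :
    (Finset.univ.filter fun k : Fin n => min ((k : ℕ) / l) (n / l - 1) = t).card
      = segmentCount n l t := by
  rw [Finset.card_filter, Fin.sum_univ_eq_sum_range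
    (fun k => if min (k / l) (n / l - 1) = t then 1 else 0), ← Finset.card_filter]
  have hd := Nat.mul_div_le n l
  rw [segmentCount]
  split_ifs with h
  · have h1 := mul_succ_le_of_lt h
    have : (Finset.range n).filter (fun k => min (k / l) (n / l - 1) = t)
        = Finset.Ico (l * t) (l * (t + 1)) := by
      ext k
      simp only [Finset.mem_filter, Finset.mem_range, Finset.mem_Ico]
      have : min (k / l) (n / l - 1) = t ↔ k / l = t := by omega
      rw [this, Nat.div_eq_iff hl, mul_comm t l, mul_add, mul_one]
      rw [mul_add, mul_one] at h1
      have := Nat.mul_le_mul_left l (show t ≤ n / l - 1 by omega)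
      omega
    rw [this, Nat.card_Ico, mul_add, mul_one]
    omega
  · have : (Finset.range n).filter (fun k => min (k / l) (n / l - 1) = t)
        = Finset.Ico (l * (n / l - 1)) n := by
      ext k
      simp only [Finset.mem_filter, Finset.mem_range, Finset.mem_Ico]
      have : min (k / l) (n / l - 1) = t ↔ n / l - 1 ≤ k / l := by omega
      rw [this, Nat.le_div_iff_mul_le hl, mul_comm _ l, and_comm]
    rw [this, Nat.card_Ico]

theorem sum_cellIndex (hy : Function.Injective y) (hl : 0 < l) (hln : l ≤ n) (f : ℕ → ℝ) :
    ∑ i, f (cellIndex (endpoints y l) y (y i))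
      = ∑ t ∈ Finset.range (n / l), segmentCount n l t * f t := by
  have hT : 0 < n / l := Nat.div_pos hln hl
  rw [← Equiv.sum_comp (Tuple.sort y)]
  simp_rw [cellIndex_sort hy hl]
  rw [← Finset.sum_fiberwise_of_maps_to (g := fun k : Fin n => min ((k : ℕ) / l) (n / l - 1))
    (t := Finset.range (n / l)) (fun k _ => by simp; omega)]
  refine Finset.sum_congr rfl fun t ht => ?_
  rw [← card_filter_min_div hl (by simpa using ht), ← nsmul_eq_mul, ← Finset.sum_const]
  refine Finset.sum_congr rfl fun k hk => ?_
  rw [(Finset.mem_filter.1 hk).2]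

/-- Cells are closed on the right, so each cell but the last contains exactly one end point, its own
right end. -/
theorem sum_cellIndex_endpoints (hy : Function.Injective y) (hl : 0 < l) (hn : 0 < n) (f : ℕ → ℝ) :
    ∑ i ∈ endpoints y l, f (cellIndex (endpoints y l) y (y i))
      = ∑ t ∈ Finset.range (n / l - 1), f t := by
  obtain ⟨k, hk, hinj, hE⟩ := exists_endpoints_eq y hl hn
  conv_lhs => enter [1]; rw [hE]
  rw [Finset.sum_image hinj]
  refine Finset.sum_congr rfl fun s hs => ?_
  have hs' : s < n / l - 1 := by simpa using hs
  have h1 := hk s hs'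
  rw [cellIndex_sort hy hl]
  congr 1
  have : (k s : ℕ) / l = s := by
    rw [Nat.div_eq_iff hl, mul_comm s l]
    rw [mul_add] at h1
    omega
  omega

theorem klEstimator_eq (q : Measure ℝ) (hl : 0 < l) (hln : l ≤ n) :
    klEstimator q l y = ∑ t ∈ Finset.range (n / l), ((segmentCount n l t : ℝ) / n) *
      Real.log (((segmentCount n l t : ℝ) / n)
        / q.real (cellIndex (endpoints y l) y ⁻¹' {t})) := by
  have hT : 0 < n / l := Nat.div_pos hln hl
  rw [klEstimator, show Finset.range (n / l) = Finset.range (n / l - 1 + 1) by congr 1; omega,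
    Finset.sum_range_succ]
  congr 1
  · refine Finset.sum_congr rfl fun t ht => ?_
    have ht' : t < n / l - 1 := by simpa using ht
    rw [sampleSegment_eq hl (by omega), segmentCount, if_pos ht']
  · rw [sampleSegment_eq hl (by omega), segmentCount, if_neg (lt_irrefl _)]

theorem sum_segmentCount (hl : 0 < l) (hln : l ≤ n) :
    ∑ t ∈ Finset.range (n / l), segmentCount n l t = n := by
  have hT : 0 < n / l := Nat.div_pos hln hl
  have hd := Nat.mul_div_le n l
  have h2 : l * (n / l - 1) ≤ l * (n / l) := Nat.mul_le_mul_left _ (by omega)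
  rw [show Finset.range (n / l) = Finset.range (n / l - 1 + 1) by congr 1; omega,
    Finset.sum_range_succ, Finset.sum_congr rfl
    (g := fun _ => l) (fun t ht => by rw [segmentCount, if_pos (by simpa using ht)])]
  simp only [Finset.sum_const, Finset.card_range, smul_eq_mul, segmentCount, lt_irrefl, if_false]
  rw [mul_comm]
  omega

theorem segmentCount_le (hl : 0 < l) (hln : l ≤ n) (t : ℕ) : segmentCount n l t ≤ 2 * l := by
  have hT : 0 < n / l := Nat.div_pos hln hl
  have h1 := Nat.div_add_mod n l
  have h2 := Nat.mod_lt n hl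
  rw [segmentCount]
  split_ifs
  · omega
  · obtain ⟨m, hm⟩ : ∃ m, n / l = m + 1 := ⟨n / l - 1, by omega⟩
    rw [hm, mul_add] at h1
    rw [hm, Nat.add_sub_cancel]
    omega

theorem le_segmentCount (hl : 0 < l) (hln : l ≤ n) (t : ℕ) : l ≤ segmentCount n l t := by
  have hT : 0 < n / l := Nat.div_pos hln hl
  have h1 := Nat.div_add_mod n l
  rw [segmentCount]
  split_ifs
  · exact le_rfl
  · obtain ⟨m, hm⟩ : ∃ m, n / l = m + 1 := ⟨n / l - 1, by omega⟩
    rw [hm, mul_add] at h1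
    rw [hm, Nat.add_sub_cancel]
    omega

end

/-! ### Exceptional null sets. -/

/-- Moving `x` up to a rational leaves countably many sets, each an interval starting at some `q`.
Such a set is locally null: a point with a larger one in the set has a null neighbourhood, and a
largest point `y` confines the set to the null interval `(q, y]`. -/
theorem measure_exists_Ioc_eq_zero (ν : Measure ℝ) : ν {y | ∃ x < y, ν (Set.Ioc x y) = 0} = 0 := by
  have hsub : {y | ∃ x < y, ν (Set.Ioc x y) = 0} ⊆
      ⋃ q : ℚ, {y : ℝ | (q : ℝ) < y ∧ ν (Set.Ioc (q : ℝ) y) = 0} := by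
    rintro y ⟨x, hxy, h⟩
    obtain ⟨q, hxq, hqy⟩ := exists_rat_btwn hxy
    exact Set.mem_iUnion.2 ⟨q, hqy, measure_mono_null (Set.Ioc_subset_Ioc_left hxq.le) h⟩
  refine measure_mono_null hsub (measure_iUnion_null fun q => ?_)
  refine measure_null_of_locally_null _ fun y hy => ?_
  by_cases hmax : ∃ y', y < y' ∧ ν (Set.Ioc (q : ℝ) y') = 0
  · obtain ⟨y', hyy', h⟩ := hmax
    exact ⟨Set.Ioc q y', mem_nhdsWithin_of_mem_nhds (Ioc_mem_nhds hy.1 hyy'), h⟩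
  · push Not at hmax
    refine ⟨_, self_mem_nhdsWithin, measure_mono_null (fun z hz => ?_) hy.2⟩
    refine ⟨hz.1, ?_⟩
    by_contra hlt
    exact hmax z (not_le.1 hlt) hz.2

theorem ae_injective_pi {ι : Type*} [Fintype ι] (ν : Measure ℝ) [IsProbabilityMeasure ν]
    [NullSingletonClass ν] : ∀ᵐ y ∂(Measure.pi fun _ : ι => ν), Function.Injective y := by
  have h : ∀ i j : ι, i ≠ j → ∀ᵐ y ∂(Measure.pi fun _ : ι => ν), y i ≠ y j := by
    intro i j hij
    have hind := (ProbabilityTheory.iIndepFun_pi (μ := fun _ : ι => ν) (X := fun _ x => x)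
      (fun _ => aemeasurable_id)).indepFun hij
    have hmap := (ProbabilityTheory.indepFun_iff_map_prod_eq_prod_map_map
      (measurable_pi_apply i).aemeasurable (measurable_pi_apply j).aemeasurable).1 hind
    rw [(measurePreserving_eval (fun _ : ι => ν) i).map_eq,
      (measurePreserving_eval (fun _ : ι => ν) j).map_eq] at hmap
    have hd : ∀ᵐ p ∂(ν.prod ν), p.1 ≠ p.2 := by
      have hm : MeasurableSet {p : ℝ × ℝ | p.1 = p.2} :=
        measurableSet_eq_fun measurable_fst measurable_snd
      change (ν.prod ν) {p : ℝ × ℝ | ¬ (p.1 ≠ p.2)} = 0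
      simp only [not_not, ne_eq]
      rw [Measure.measure_prod_null hm]
      refine Eventually.of_forall fun x => ?_
      have : Prod.mk x ⁻¹' {p : ℝ × ℝ | p.1 = p.2} = {x} := by
        ext z; simp [eq_comm]
      simp [this]
    rw [← hmap] at hd
    exact ae_of_ae_map (f := fun y : ι → ℝ => (y i, y j)) (by fun_prop) hd
  have : ∀ᵐ y ∂(Measure.pi fun _ : ι => ν), ∀ i j : ι, i ≠ j → y i ≠ y j :=
    eventually_all.2 fun i => eventually_all.2 fun j => by
      by_cases hij : i = j
      · simp [hij]
      · simpa [hij] using h i j hij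
  filter_upwards [this] with y hy i j hyij
  by_contra hij
  exact hy i j hij hyij

/-! ### Histogram densities and their expectations. -/

section
variable {ι : Type*}

theorem measurable_cellIndex_prod (E : Finset ι) :
    Measurable fun p : (ι → ℝ) × ℝ => cellIndex E p.1 p.2 := by
  have : (fun p : (ι → ℝ) × ℝ => cellIndex E p.1 p.2)
      = fun p => ∑ i ∈ E, if p.1 i < p.2 then 1 else 0 := by
    ext p
    rw [cellIndex, Finset.card_filter]
  rw [this]
  refine Finset.measurable_sum _ fun i _ => ?_
  refine Measurable.ite ?_ measurable_const measurable_const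
  exact measurableSet_lt ((measurable_pi_apply i).comp measurable_fst) measurable_snd

/-- The density with respect to `ν` of the histogram that gives the cell `t` of the partition with
end points `y i`, `i ∈ E`, the mass `p t`. -/
noncomputable def histogram (E : Finset ι) (ν : Measure ℝ) (p : ℕ → ℝ≥0∞) (y : ι → ℝ) (x : ℝ) :
    ℝ≥0∞ :=
  p (cellIndex E y x) / ν (cellIndex E y ⁻¹' {cellIndex E y x})

theorem measurable_histogram (E : Finset ι) (ν : Measure ℝ) [IsProbabilityMeasure ν]
    (p : ℕ → ℝ≥0∞) : Measurable fun q : (ι → ℝ) × ℝ => histogram E ν p q.1 q.2 := by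
  have h : Measurable fun q : ℕ × (ι → ℝ) => p q.1 / ν (cellIndex E q.2 ⁻¹' {q.1}) := by
    refine measurable_from_prod_countable_right fun t => ?_
    refine Measurable.div (measurable_const (a := p t)) ?_
    exact measurable_measure_prodMk_left
      (measurable_cellIndex_prod E (MeasurableSet.singleton t))
  exact h.comp ((measurable_cellIndex_prod E).prodMk measurable_fst)

theorem measurable_prod_histogram (E s : Finset ι) (ν : Measure ℝ) [IsProbabilityMeasure ν]
    (p : ℕ → ℝ≥0∞) : Measurable fun y : ι → ℝ => ∏ j ∈ s, histogram E ν p y (y j) :=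
  Finset.measurable_prod _ fun j _ =>
    (measurable_histogram E ν p).comp (measurable_id.prodMk (measurable_pi_apply j))

/-- Each cell contributes its prescribed mass, or nothing if it is `ν`-null; hence only an
inequality. -/
theorem lintegral_histogram_le (E : Finset ι) (ν : Measure ℝ) (p : ℕ → ℝ≥0∞) (y : ι → ℝ) :
    ∫⁻ x, histogram E ν p y x ∂ν ≤ ∑ t ∈ Finset.range (E.card + 1), p t := by
  have h : ∀ x, histogram E ν p y x = ∑ t ∈ Finset.range (E.card + 1),
      (cellIndex E y ⁻¹' {t}).indicator (fun _ => p t / ν (cellIndex E y ⁻¹' {t})) x := by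
    intro x
    rw [Finset.sum_eq_single (cellIndex E y x)]
    · simp [histogram]
    · intro t _ ht
      simp [ht.symm]
    · intro hx
      exact absurd (Nat.lt_succ_of_le (cellIndex_le E y x)) (by simpa using hx)
  have hm : ∀ t, MeasurableSet (cellIndex E y ⁻¹' {t}) := fun t =>
    measurable_cellIndex E y (MeasurableSet.singleton t)
  simp_rw [h]
  rw [lintegral_finsetSum _ fun t _ => measurable_const.indicator (hm t)]
  refine Finset.sum_le_sum fun t _ => ?_
  rw [lintegral_indicator_const (hm t), mul_comm]
  exact ENNReal.mul_div_le

theorem lintegral_pi_prod_eq_pow [Fintype ι] (ν : Measure ℝ) [IsProbabilityMeasure ν]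
    {f : ℝ → ℝ≥0∞} (hf : Measurable f) :
    ∫⁻ y, ∏ j, f (y j) ∂(Measure.pi fun _ : ι => ν) = (∫⁻ x, f x ∂ν) ^ Fintype.card ι := by
  have hind : ProbabilityTheory.iIndepFun (fun (j : ι) (y : ι → ℝ) => f (y j))
      (Measure.pi fun _ : ι => ν) :=
    ProbabilityTheory.iIndepFun_pi (X := fun _ => f) fun _ => hf.aemeasurable
  have hint : ∀ j : ι, ∫⁻ y, f (y j) ∂(Measure.pi fun _ : ι => ν) = ∫⁻ x, f x ∂ν :=
    fun j => (measurePreserving_eval (fun _ : ι => ν) j).lintegral_comp hf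
  rw [ProbabilityTheory.lintegral_prod_eq_prod_lintegral_of_indepFun Finset.univ _ hind
    fun j => hf.comp (measurable_pi_apply j)]
  simp [hint]

/-- The cells depend only on the coordinates in `E`. With these frozen, the remaining coordinates
are i.i.d. and the integral is a power of a number at most 1. -/
theorem lintegral_prod_histogram_le [Fintype ι] [DecidableEq ι] (E : Finset ι) (ν : Measure ℝ)
    [IsProbabilityMeasure ν]
    {p : ℕ → ℝ≥0∞} (hp : ∑ t ∈ Finset.range (E.card + 1), p t ≤ 1) :
    ∫⁻ y, ∏ j ∈ Eᶜ, histogram E ν p y (y j) ∂(Measure.pi fun _ : ι => ν) ≤ 1 := by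
  have hone : ∫⁻ _ : ι → ℝ, (1 : ℝ≥0∞) ∂(Measure.pi fun _ : ι => ν) = 1 := by simp
  rw [← hone]
  refine lintegral_le_of_lmarginal_le Eᶜ (measurable_prod_histogram E Eᶜ ν p)
    measurable_const fun y => ?_
  simp only [lmarginal, lintegral_const, measure_univ, mul_one]
  have hcell : ∀ z : (Eᶜ : Finset ι) → ℝ,
      ∏ j ∈ Eᶜ, histogram E ν p (Function.updateFinset y Eᶜ z) (Function.updateFinset y Eᶜ z j)
        = ∏ j : (Eᶜ : Finset ι), histogram E ν p y (z j) := by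
    intro z
    have hE : cellIndex E (Function.updateFinset y Eᶜ z) = cellIndex E y := by
      ext x
      rw [cellIndex, cellIndex]
      congr 1
      refine Finset.filter_congr fun i hi => ?_
      simp [Function.updateFinset, hi]
    rw [← Finset.prod_coe_sort]
    refine Finset.prod_congr rfl fun j _ => ?_
    simp only [histogram, hE]
    have : Function.updateFinset y Eᶜ z j = z j := by
      simp only [Function.updateFinset, j.2, dif_pos]
    rw [this]
  simp_rw [hcell]
  have hm : Measurable (histogram E ν p y) :=
    (measurable_histogram E ν p).comp (measurable_const.prodMk measurable_id)
  rw [lintegral_pi_prod_eq_pow ν hm]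
  exact pow_le_one' ((lintegral_histogram_le E ν p y).trans hp) _

end

/-! ### Generic samples: all cells that matter have positive mass. -/

/-- The sample points are distinct, and every left neighbourhood of a sample point has positive
mass under `q`. -/
structure IsGenericSample {ι : Type*} (q : Measure ℝ) (y : ι → ℝ) : Prop where
  injective : Function.Injective y
  pos : ∀ i, ∀ x < y i, q (Set.Ioc x (y i)) ≠ 0

theorem ae_isGenericSample {ι : Type*} [Fintype ι] {ρ q : Measure ℝ} [IsProbabilityMeasure ρ]
    [NullSingletonClass ρ] (hac : ρ ≪ q) :
    ∀ᵐ y ∂(Measure.pi fun _ : ι => ρ), IsGenericSample q y := by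
  have h0 : ∀ᵐ x ∂q, ¬ ∃ z < x, q (Set.Ioc z x) = 0 := by
    rw [ae_iff]
    simpa using measure_exists_Ioc_eq_zero q
  have h : ∀ᵐ x ∂ρ, ¬ ∃ z < x, q (Set.Ioc z x) = 0 := hac.ae_le h0
  have h2 : ∀ᵐ y ∂(Measure.pi fun _ : ι => ρ), ∀ i, ¬ ∃ z < y i, q (Set.Ioc z (y i)) = 0 :=
    eventually_all.2 fun i =>
      (Measure.tendsto_eval_ae_ae (μ := fun _ : ι => ρ) (i := i)).eventually h
  filter_upwards [ae_injective_pi ρ, h2] with y hy hy2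
  refine ⟨hy, fun i x hx h0 => hy2 i ⟨x, hx, h0⟩⟩

theorem exists_Ioc_subset_cell {ι : Type*} (E : Finset ι) (y : ι → ℝ) (b : ℝ) :
    ∃ x < b, Set.Ioc x b ⊆ cellIndex E y ⁻¹' {cellIndex E y b} := by
  have h : ∀ᶠ x in nhdsWithin b (Set.Iio b), ∀ i ∈ E, y i < b → y i < x := by
    refine (Finset.eventually_all E).2 fun i _ => ?_
    by_cases hi : y i < b
    · filter_upwards [mem_nhdsWithin_of_mem_nhds (Ioi_mem_nhds hi)] with x hx _ using hx
    · exact Eventually.of_forall fun x h => absurd h hi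
  obtain ⟨x, hx, hxb⟩ := (h.and self_mem_nhdsWithin).exists
  refine ⟨x, hxb, fun z hz => ?_⟩
  rw [Set.mem_preimage, Set.mem_singleton_iff, cellIndex, cellIndex]
  congr 1
  refine Finset.filter_congr fun i hi => ⟨fun h => h.trans_le hz.2, fun h => (hx i hi h).trans hz.1⟩

/-! ### Upper tail of the estimator under the typical law. -/

section
variable {n l : ℕ} {q : Measure ℝ} [IsProbabilityMeasure q] {y : Fin n → ℝ}

theorem IsGenericSample.cell_pos (hy : IsGenericSample q y) (E : Finset (Fin n)) (i : Fin n) :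
    0 < q.real (cellIndex E y ⁻¹' {cellIndex E y (y i)}) := by
  obtain ⟨x, hx, hsub⟩ := exists_Ioc_subset_cell E y (y i)
  refine ENNReal.toReal_pos (fun h => hy.pos i x hx (measure_mono_null hsub h)) (measure_ne_top _ _)

theorem IsGenericSample.segment_pos (hy : IsGenericSample q y) (hl : 0 < l) {t : ℕ}
    (ht : t < n / l) : 0 < q.real (cellIndex (endpoints y l) y ⁻¹' {t}) := by
  have h1 : l * (t + 1) ≤ n := (Nat.mul_le_mul_left _ ht).trans (Nat.mul_div_le n l)
  have h2 : l * t < n := by rw [mul_add] at h1; omega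
  have := hy.cell_pos (endpoints y l) (Tuple.sort y ⟨l * t, h2⟩)
  rw [cellIndex_sort hy.injective hl] at this
  simp only [Nat.mul_div_cancel_left _ hl] at this
  rwa [min_eq_left (by omega)] at this

/-- Dropping the end points removes one of `l` points from every cell but the last, which scales
those terms by `1 - 1 / l`. The last cell keeps all its `ε ≤ 2 * l` points, leaving an extra `ε / l
≤ 2` times its log-ratio, which is at least `-log n`. -/
theorem sum_log_compl_endpoints_ge (hy : IsGenericSample q y) (hl : 0 < l) (hln : l ≤ n) :
    (1 - 1 / (l : ℝ)) * (n * klEstimator q l y) - 2 * Real.log n ≤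
      ∑ j ∈ (endpoints y l)ᶜ, Real.log
        (((segmentCount n l (cellIndex (endpoints y l) y (y j)) : ℝ) / n)
          / q.real (cellIndex (endpoints y l) y ⁻¹' {cellIndex (endpoints y l) y (y j)})) := by
  have hn : 0 < n := hl.trans_le hln
  have hn' : (0 : ℝ) < n := by exact_mod_cast hn
  have hl' : (0 : ℝ) < l := by exact_mod_cast hl
  have hT : 0 < n / l := Nat.div_pos hln hl
  set φ : ℕ → ℝ := fun t => Real.log (((segmentCount n l t : ℝ) / n)
    / q.real (cellIndex (endpoints y l) y ⁻¹' {t})) with hφ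
  change _ ≤ ∑ j ∈ (endpoints y l)ᶜ, φ (cellIndex (endpoints y l) y (y j))
  have h1 := Finset.sum_compl_add_sum (endpoints y l)
    fun j => φ (cellIndex (endpoints y l) y (y j))
  rw [sum_cellIndex_endpoints hy.injective hl hn, sum_cellIndex hy.injective hl hln] at h1
  have h2 : n * klEstimator q l y = ∑ t ∈ Finset.range (n / l), segmentCount n l t * φ t := by
    rw [klEstimator_eq q hl hln, Finset.mul_sum]
    refine Finset.sum_congr rfl fun t _ => ?_
    rw [← mul_assoc, mul_div_cancel₀ _ hn'.ne']
  have h3 : ∑ t ∈ Finset.range (n / l), segmentCount n l t * φ t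
      = l * ∑ t ∈ Finset.range (n / l - 1), φ t
        + segmentCount n l (n / l - 1) * φ (n / l - 1) := by
    rw [show Finset.range (n / l) = Finset.range (n / l - 1 + 1) by congr 1; omega,
      Finset.sum_range_succ, Finset.mul_sum]
    congr 1
    refine Finset.sum_congr rfl fun t ht => ?_
    rw [segmentCount, if_pos (by simpa using ht)]
  have hle := segmentCount_le hl hln (n / l - 1)
  have hge := le_segmentCount hl hln (n / l - 1)
  set ε := segmentCount n l (n / l - 1)
  have hφT : - Real.log n ≤ φ (n / l - 1) := by
    have hW := hy.segment_pos hl (t := n / l - 1) (by omega)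
    have hW1 : q.real (cellIndex (endpoints y l) y ⁻¹' {n / l - 1}) ≤ 1 := measureReal_le_one
    rw [← Real.log_inv]
    refine Real.log_le_log (by positivity) ?_
    rw [le_div_iff₀ hW]
    have : (1 : ℝ) ≤ ε := by exact_mod_cast hl.trans_le hge
    calc (n : ℝ)⁻¹ * _ ≤ (n : ℝ)⁻¹ * 1 := by gcongr
      _ ≤ ε / n := by rw [mul_one, inv_eq_one_div]; gcongr
  have hlog : 0 ≤ Real.log n := Real.log_nonneg (by exact_mod_cast hn)
  have h4 : ∑ j ∈ (endpoints y l)ᶜ, φ (cellIndex (endpoints y l) y (y j))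
      = (1 - 1 / (l : ℝ)) * (n * klEstimator q l y) + (ε / l) * φ (n / l - 1) := by
    rw [h2, h3]
    rw [h3] at h1
    field_simp
    linear_combination l * h1
  rw [h4]
  have h5 : (ε : ℝ) / l ≤ 2 := by
    rw [div_le_iff₀ hl']
    exact_mod_cast hle
  have h6 : 0 ≤ (ε : ℝ) / l := by positivity
  nlinarith [mul_le_mul_of_nonneg_left hφT h6, mul_le_mul_of_nonneg_right h5 hlog]

theorem prod_histogram_ge (hy : IsGenericSample q y) (hl : 0 < l) (hln : l ≤ n) {c : ℝ}
    (hc : c ≤ klEstimator q l y) :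
    ENNReal.ofReal (Real.exp ((1 - 1 / (l : ℝ)) * (n * c) - 2 * Real.log n)) ≤
      ∏ j ∈ (endpoints y l)ᶜ, histogram (endpoints y l) q
        (fun t => ENNReal.ofReal ((segmentCount n l t : ℝ) / n)) y (y j) := by
  have hn : 0 < n := hl.trans_le hln
  have hn' : (0 : ℝ) < n := by exact_mod_cast hn
  set E := endpoints y l with hE
  have hpos : ∀ j, 0 < ((segmentCount n l (cellIndex E y (y j)) : ℝ) / n)
      / q.real (cellIndex E y ⁻¹' {cellIndex E y (y j)}) := by
    intro j
    have h1 : (0 : ℝ) < segmentCount n l (cellIndex E y (y j)) := by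
      exact_mod_cast hl.trans_le (le_segmentCount hl hln _)
    exact div_pos (div_pos h1 hn') (hy.cell_pos E j)
  have hh : ∀ j, histogram E q (fun t => ENNReal.ofReal ((segmentCount n l t : ℝ) / n)) y (y j)
      = ENNReal.ofReal (((segmentCount n l (cellIndex E y (y j)) : ℝ) / n)
      / q.real (cellIndex E y ⁻¹' {cellIndex E y (y j)})) := by
    intro j
    rw [ENNReal.ofReal_div_of_pos (hy.cell_pos E j), ofReal_measureReal, histogram]
  simp_rw [hh]
  rw [← ENNReal.ofReal_prod_of_nonneg fun j _ => (hpos j).le]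
  refine ENNReal.ofReal_le_ofReal ?_
  rw [← Finset.prod_congr rfl fun j _ => Real.exp_log (hpos j), ← Real.exp_sum]
  refine Real.exp_le_exp.2 (le_trans ?_ (sum_log_compl_endpoints_ge hy hl hln))
  have h1 : 0 ≤ 1 - 1 / (l : ℝ) := by
    rw [sub_nonneg, div_le_one (by exact_mod_cast hl)]
    exact_mod_cast hl
  gcongr

variable [NullSingletonClass q]

theorem measure_le_klEstimator_le (hl : 0 < l) (hln : l ≤ n) (c : ℝ) :
    (Measure.pi fun _ : Fin n => q) {y | c ≤ klEstimator q l y} ≤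
      ENNReal.ofReal ((n.choose (n / l - 1) : ℝ) *
        Real.exp (2 * Real.log n - (1 - 1 / (l : ℝ)) * (n * c))) := by
  have hn : 0 < n := hl.trans_le hln
  have hT : 0 < n / l := Nat.div_pos hln hl
  set p : ℕ → ℝ≥0∞ := fun t => ENNReal.ofReal ((segmentCount n l t : ℝ) / n) with hp
  -- The index set of the end points is random; the sum over all sets of its size dominates the term
  -- that occurs.
  set F : (Fin n → ℝ) → ℝ≥0∞ := fun y => ∑ E ∈ Finset.univ.powersetCard (n / l - 1),
    ∏ j ∈ Eᶜ, histogram E q p y (y j) with hF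
  have hmeas : ∀ E : Finset (Fin n), Measurable fun y : Fin n → ℝ =>
      ∏ j ∈ Eᶜ, histogram E q p y (y j) := fun E => measurable_prod_histogram E Eᶜ q p
  have hint : ∫⁻ y, F y ∂(Measure.pi fun _ : Fin n => q) ≤ n.choose (n / l - 1) := by
    rw [hF, lintegral_finsetSum _ fun E _ => hmeas E]
    refine (Finset.sum_le_card_nsmul _ _ 1 fun E hE => ?_).trans ?_
    · refine lintegral_prod_histogram_le E q ?_
      rw [(Finset.mem_powersetCard.1 hE).2, Nat.sub_add_cancel hT, hp,
        ← ENNReal.ofReal_sum_of_nonneg fun t _ => by positivity, ← Finset.sum_div,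
        ← Nat.cast_sum, sum_segmentCount hl hln, div_self (by exact_mod_cast hn.ne')]
      simp
    · simp
  set a : ℝ := (1 - 1 / (l : ℝ)) * (n * c) - 2 * Real.log n with ha
  have hae : ∀ᵐ y ∂(Measure.pi fun _ : Fin n => q),
      c ≤ klEstimator q l y → ENNReal.ofReal (Real.exp a) ≤ F y := by
    filter_upwards [ae_isGenericSample (ι := Fin n) (Measure.AbsolutelyContinuous.refl q)]
      with y hy hcy
    refine (prod_histogram_ge hy hl hln hcy).trans ?_
    exact Finset.single_le_sum (f := fun E => ∏ j ∈ Eᶜ, histogram E q p y (y j))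
      (fun _ _ => zero_le) (by simp [card_endpoints y hl hn])
  calc (Measure.pi fun _ : Fin n => q) {y | c ≤ klEstimator q l y}
      ≤ (Measure.pi fun _ : Fin n => q) {y | ENNReal.ofReal (Real.exp a) ≤ F y} :=
        measure_mono_ae hae
    _ ≤ (∫⁻ y, F y ∂(Measure.pi fun _ : Fin n => q)) / ENNReal.ofReal (Real.exp a) :=
        meas_ge_le_lintegral_div (Finset.measurable_sum _ fun E _ => hmeas E).aemeasurable
          (by simp [Real.exp_pos]) ENNReal.ofReal_ne_top
    _ ≤ (n.choose (n / l - 1) : ℝ≥0∞) / ENNReal.ofReal (Real.exp a) := by gcongr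
    _ = _ := by
        rw [← ENNReal.ofReal_natCast, ← ENNReal.ofReal_div_of_pos (Real.exp_pos a), div_eq_mul_inv,
          ← Real.exp_neg, ha, neg_sub]

end

/-! ### Lower bound for the estimator and concentration. -/

theorem exists_breakpoints {G : ℝ → ℝ} (hG : Continuous G) (hc : HasCompactSupport G) {ε : ℝ}
    (hε : 0 < ε) :
    ∃ B : Finset ℝ, ∀ x y, x < y → ε < |G x - G y| → ∃ b ∈ B, x ≤ b ∧ b ≤ y := by
  obtain ⟨δ, hδ, hu⟩ := Metric.uniformContinuous_iff.1
    (hc.uniformContinuous_of_continuous hG) ε hε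
  obtain ⟨R, hR⟩ := hc.isCompact.isBounded.subset_closedBall 0
  have hsupp : ∀ x, R < |x| → G x = 0 := by
    intro x hx
    by_contra h
    have := hR (subset_tsupport G h)
    rw [mem_closedBall_zero_iff, Real.norm_eq_abs] at this
    exact absurd hx (not_lt.2 this)
  set m := δ / 2 with hm
  have hm0 : 0 < m := by positivity
  -- The mesh is half the continuity modulus `δ`: a large difference forces `y - x ≥ δ` and an end
  -- in `[-R, R]`, and rounding that end inwards stays between `x` and `y`.
  refine ⟨(Finset.Icc (⌊-R / m⌋ - 2) (⌈R / m⌉ + 2)).image fun k : ℤ => k * m, fun x y hxy h => ?_⟩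
  have hlen : δ ≤ y - x := by
    by_contra hlt
    have := hu (a := x) (b := y) (by rw [dist_comm, Real.dist_eq, abs_of_pos (by linarith)]; linarith)
    rw [Real.dist_eq] at this
    linarith
  simp only [Finset.mem_image, Finset.mem_Icc, exists_exists_and_eq_and]
  have key : ∀ z : ℝ, |z| ≤ R → -R / m ≤ z / m ∧ z / m ≤ R / m := fun z hz => by
    have := abs_le.1 hz
    constructor <;> gcongr <;> linarith
  by_cases hx : |x| ≤ R
  · refine ⟨⌈x / m⌉, ?_, ?_, ?_⟩
    · obtain ⟨h1, h2⟩ := key x hx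
      have := Int.floor_le_ceil (-R / m)
      have := Int.floor_le_floor h1
      have := Int.floor_le_ceil (x / m)
      have := Int.ceil_le_ceil h2
      omega
    · exact (div_le_iff₀ hm0).1 (Int.le_ceil _)
    · have := Int.ceil_lt_add_one (x / m)
      have := mul_le_mul_of_nonneg_right this.le hm0.le
      rw [add_mul, div_mul_cancel₀ _ hm0.ne'] at this
      linarith
  · by_cases hy : |y| ≤ R
    · refine ⟨⌊y / m⌋, ?_, ?_, ?_⟩
      · obtain ⟨h1, h2⟩ := key y hy
        have := Int.floor_le_floor h1
        have := Int.floor_le_ceil (y / m)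
        have := Int.ceil_le_ceil h2
        omega
      · have := Int.sub_one_lt_floor (y / m)
        have := mul_le_mul_of_nonneg_right this.le hm0.le
        rw [sub_mul, div_mul_cancel₀ _ hm0.ne'] at this
        linarith
      · exact (le_div_iff₀ hm0).1 (Int.floor_le _)
    · rw [hsupp x (not_le.1 hx), hsupp y (not_le.1 hy), sub_zero, abs_zero] at h
      exact absurd h (not_lt.2 hε.le)

/-- Donsker–Varadhan for the discretized laws, tested on the cellwise infimum `g` of `G`; the
infimum keeps the exponential moment below that of `G`. Replacing `g` by `G` in the empirical mean
costs `ε`, except in the at most `B.card` cells that contain a breakpoint, each with at most `2 * l`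
samples. -/
theorem klEstimator_ge {n l : ℕ} {q : Measure ℝ} [IsProbabilityMeasure q] {y : Fin n → ℝ}
    (hy : IsGenericSample q y) (hl : 0 < l) (hln : l ≤ n) {G : ℝ → ℝ} (hG : Measurable G)
    {a b ε : ℝ} (hab : ∀ x, G x ∈ Set.Icc a b) (hε : 0 ≤ ε) {B : Finset ℝ}
    (hB : ∀ x y, x < y → ε < |G x - G y| → ∃ c ∈ B, x ≤ c ∧ c ≤ y) :
    (∑ i, G (y i)) / n - ε - B.card * (2 * l / n) * (b - a) - (∫ x, Real.exp (G x) ∂q - 1)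
      ≤ klEstimator q l y := by
  have hn : 0 < n := hl.trans_le hln
  have hn' : (0 : ℝ) < n := by exact_mod_cast hn
  have hba : 0 ≤ b - a := sub_nonneg.2 ((hab 0).1.trans (hab 0).2)
  set τ := cellIndex (endpoints y l) y with hτ
  have hmono : Monotone τ := cellIndex_mono _ _
  have hmeas : ∀ t, MeasurableSet (τ ⁻¹' {t}) := fun t =>
    measurable_cellIndex _ _ (MeasurableSet.singleton t)
  set g : ℕ → ℝ := fun t => sInf (G '' (τ ⁻¹' {t})) with hg
  have hbdd : ∀ t, BddBelow (G '' (τ ⁻¹' {t})) := fun t =>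
    ⟨a, by rintro _ ⟨x, -, rfl⟩; exact (hab x).1⟩
  have hgle : ∀ x, g (τ x) ≤ G x := fun x => csInf_le (hbdd _) ⟨x, rfl, rfl⟩
  have hlt : ∀ i, τ (y i) < n / l := by
    intro i
    have h1 := cellIndex_le (endpoints y l) y (y i)
    rw [card_endpoints y hl hn] at h1
    have := Nat.div_pos hln hl
    exact lt_of_le_of_lt h1 (by omega)
  have hint : Integrable (fun x => Real.exp (G x)) q := by
    refine Integrable.of_mem_Icc (Real.exp a) (Real.exp b)
      (Real.measurable_exp.comp hG).aemeasurable (Eventually.of_forall fun x => ?_)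
    exact ⟨Real.exp_le_exp.2 (hab x).1, Real.exp_le_exp.2 (hab x).2⟩
  have hmass : ∑ t ∈ Finset.range (n / l), q.real (τ ⁻¹' {t}) * Real.exp (g t)
      ≤ ∫ x, Real.exp (G x) ∂q := by
    calc _ ≤ ∑ t ∈ Finset.range (n / l), ∫ x in τ ⁻¹' {t}, Real.exp (G x) ∂q := by
          refine Finset.sum_le_sum fun t _ => ?_
          rw [mul_comm]
          refine setIntegral_ge_of_const_le_real (hmeas t) (measure_ne_top _ _) ?_ hint.integrableOn
          rintro x rfl
          exact Real.exp_le_exp.2 (hgle x)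
      _ = ∫ x in ⋃ t ∈ Finset.range (n / l), τ ⁻¹' {t}, Real.exp (G x) ∂q := by
          rw [integral_biUnion_finset _ (fun t _ => hmeas t) _ fun t _ => hint.integrableOn]
          intro s _ t _ hst
          exact Disjoint.preimage _ (Set.disjoint_singleton.2 hst)
      _ ≤ ∫ x, Real.exp (G x) ∂q :=
          setIntegral_le_integral hint (Eventually.of_forall fun x => (Real.exp_pos _).le)
  have hterm : ∀ t ∈ Finset.range (n / l),
      ((segmentCount n l t : ℝ) / n) * g t + (segmentCount n l t : ℝ) / n
        - q.real (τ ⁻¹' {t}) * Real.exp (g t) ≤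
      ((segmentCount n l t : ℝ) / n) * Real.log (((segmentCount n l t : ℝ) / n)
        / q.real (τ ⁻¹' {t})) := by
    intro t ht
    have hW : 0 < q.real (τ ⁻¹' {t}) := hy.segment_pos hl (by simpa using ht)
    have hp : 0 < (segmentCount n l t : ℝ) / n := by
      have : (0 : ℝ) < segmentCount n l t := by exact_mod_cast hl.trans_le (le_segmentCount hl hln t)
      positivity
    set p := (segmentCount n l t : ℝ) / n
    set W := q.real (τ ⁻¹' {t})
    -- `log x ≤ x - 1` gives the linearized variational bound, with `∫ exp G - 1` in place of its
    -- logarithm.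
    have h1 := Real.log_le_sub_one_of_pos (x := W * Real.exp (g t) / p)
      (div_pos (mul_pos hW (Real.exp_pos _)) hp)
    rw [Real.log_div (mul_pos hW (Real.exp_pos _)).ne' hp.ne', Real.log_mul hW.ne'
      (Real.exp_pos _).ne', Real.log_exp] at h1
    rw [Real.log_div hp.ne' hW.ne']
    have h2 := mul_le_mul_of_nonneg_left h1 hp.le
    have h3 : p * (W * Real.exp (g t) / p - 1) = W * Real.exp (g t) - p := by field_simp
    rw [h3] at h2
    linarith
  have hsum := Finset.sum_le_sum hterm
  rw [← klEstimator_eq q hl hln, Finset.sum_sub_distrib, Finset.sum_add_distrib,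
    ← Finset.sum_div, ← Nat.cast_sum, sum_segmentCount hl hln, div_self hn'.ne'] at hsum
  have hpg : ∑ t ∈ Finset.range (n / l), ((segmentCount n l t : ℝ) / n) * g t
      = (∑ i, g (τ (y i))) / n := by
    rw [hτ, sum_cellIndex hy.injective hl hln, Finset.sum_div]
    refine Finset.sum_congr rfl fun t _ => by ring
  classical
  -- A breakpoint between two points of one cell lies in that cell, by monotonicity of `τ`.
  have hpoint : ∀ i, G (y i) ≤ g (τ (y i)) + ε + if τ (y i) ∈ B.image τ then (b - a) else 0 := by
    intro i
    have hne : (G '' (τ ⁻¹' {τ (y i)})).Nonempty := ⟨_, y i, rfl, rfl⟩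
    split_ifs with h
    · have : a ≤ g (τ (y i)) := le_csInf hne (by rintro _ ⟨x, -, rfl⟩; exact (hab x).1)
      linarith [(hab (y i)).2]
    · have : G (y i) - ε ≤ g (τ (y i)) := by
        refine le_csInf hne ?_
        rintro _ ⟨x, hx, rfl⟩
        by_contra hcon
        have habs : ε < |G x - G (y i)| := by
          rw [abs_sub_comm]
          exact lt_of_lt_of_le (by linarith) (le_abs_self _)
        apply h
        rcases lt_trichotomy x (y i) with hlt' | heq | hlt'
        · obtain ⟨c, hc, h1, h2⟩ := hB _ _ hlt' habs
          refine Finset.mem_image.2 ⟨c, hc, le_antisymm (hmono h2) ?_⟩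
          exact (Set.mem_singleton_iff.1 hx).symm.le.trans (hmono h1)
        · rw [heq, sub_self, abs_zero] at habs
          exact absurd habs (not_lt.2 hε)
        · rw [abs_sub_comm] at habs
          obtain ⟨c, hc, h1, h2⟩ := hB _ _ hlt' habs
          refine Finset.mem_image.2 ⟨c, hc, le_antisymm ?_ (hmono h1)⟩
          exact (hmono h2).trans (Set.mem_singleton_iff.1 hx).le
      linarith
  have hbad : ∑ i, (if τ (y i) ∈ B.image τ then (b - a) else 0) ≤ B.card * (2 * l) * (b - a) := by
    rw [hτ, sum_cellIndex hy.injective hl hln fun t => if t ∈ B.image τ then (b - a) else 0]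
    simp_rw [mul_ite, mul_zero]
    rw [← Finset.sum_filter]
    calc _ ≤ ∑ t ∈ (Finset.range (n / l)).filter (· ∈ B.image τ), (2 * l : ℝ) * (b - a) := by
          refine Finset.sum_le_sum fun t _ => ?_
          have : (segmentCount n l t : ℝ) ≤ 2 * l := by exact_mod_cast segmentCount_le hl hln t
          gcongr
      _ = ((Finset.range (n / l)).filter (· ∈ B.image τ)).card * ((2 * l : ℝ) * (b - a)) := by
          rw [Finset.sum_const, nsmul_eq_mul]
      _ ≤ B.card * ((2 * l : ℝ) * (b - a)) := by
          have : ((Finset.range (n / l)).filter (· ∈ B.image τ)).card ≤ B.card :=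
            (Finset.card_le_card fun t ht => (Finset.mem_filter.1 ht).2).trans
              Finset.card_image_le
          gcongr
      _ = _ := by ring
  have hG1 := Finset.sum_le_sum fun i (_ : i ∈ Finset.univ) => hpoint i
  rw [Finset.sum_add_distrib, Finset.sum_add_distrib] at hG1
  simp only [Finset.sum_const, Finset.card_univ, Fintype.card_fin, nsmul_eq_mul] at hG1
  have hG2 : (∑ i, G (y i)) / n ≤ (∑ i, g (τ (y i))) / n + ε + B.card * (2 * l / n) * (b - a) := by
    rw [div_le_iff₀ hn']
    have : ((∑ i, g (τ (y i))) / n + ε + B.card * (2 * l / n) * (b - a)) * n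
      = (∑ i, g (τ (y i))) + n * ε + B.card * (2 * l) * (b - a) := by field_simp
    rw [this]
    linarith
  rw [hpg] at hsum
  linarith

theorem measure_sum_le_le {n : ℕ} {ρ : Measure ℝ} [IsProbabilityMeasure ρ] {G : ℝ → ℝ}
    (hG : Measurable G) {a b : ℝ} (hab : ∀ x, G x ∈ Set.Icc a b) {s : ℝ} (hs : 0 ≤ s) :
    (Measure.pi fun _ : Fin n => ρ) {y | ∑ i, G (y i) ≤ n * (∫ x, G x ∂ρ - s)} ≤
      ENNReal.ofReal (Real.exp (-(2 * n * s ^ 2 / (b - a) ^ 2))) := by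
  have hsub : ∀ i : Fin n, ProbabilityTheory.HasSubgaussianMGF
      (fun y : Fin n → ℝ => -(G (y i) - ∫ x, G x ∂ρ)) ((‖b - a‖₊ / 2) ^ 2)
      (Measure.pi fun _ : Fin n => ρ) := by
    intro i
    have h := ProbabilityTheory.hasSubgaussianMGF_of_mem_Icc
      (μ := Measure.pi fun _ : Fin n => ρ) (X := fun y : Fin n → ℝ => G (y i))
      (hG.comp (measurable_pi_apply i)).aemeasurable (Eventually.of_forall fun y => hab (y i))
    have hint : ∫ y, G (y i) ∂(Measure.pi fun _ : Fin n => ρ) = ∫ x, G x ∂ρ := by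
      conv_rhs => rw [← (measurePreserving_eval (fun _ : Fin n => ρ) i).map_eq]
      rw [integral_map (measurable_pi_apply i).aemeasurable hG.aestronglyMeasurable]
    rw [hint] at h
    exact h.neg
  have hind : ProbabilityTheory.iIndepFun
      (fun (i : Fin n) (y : Fin n → ℝ) => -(G (y i) - ∫ x, G x ∂ρ))
      (Measure.pi fun _ : Fin n => ρ) :=
    ProbabilityTheory.iIndepFun_pi (X := fun _ x => -(G x - ∫ x, G x ∂ρ))
      fun _ => (hG.sub_const _).neg.aemeasurable
  have h := ProbabilityTheory.HasSubgaussianMGF.measure_sum_ge_le_of_iIndepFun hind (s := Finset.univ)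
    (fun i _ => hsub i) (ε := n * s) (by positivity)
  rw [Measure.real, ← ENNReal.le_ofReal_iff_toReal_le (measure_ne_top _ _) (Real.exp_pos _).le] at h
  refine (measure_mono fun y hy => ?_).trans (h.trans (ENNReal.ofReal_le_ofReal ?_))
  · simp only [Set.mem_ofPred_eq, Finset.sum_neg_distrib, Finset.sum_sub_distrib, Finset.sum_const,
      Finset.card_univ, Fintype.card_fin, nsmul_eq_mul] at hy ⊢
    linarith
  · refine Real.exp_le_exp.2 (le_of_eq ?_)
    simp only [Finset.sum_const, Finset.card_univ, Fintype.card_fin, nsmul_eq_mul]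
    push_cast
    rw [Real.norm_eq_abs, div_pow, sq_abs]
    rcases Nat.eq_zero_or_pos n with rfl | hn
    · simp
    -- In the degenerate case division by zero makes both exponents zero.
    by_cases hba : b - a = 0
    · simp [hba]
    have : (n : ℝ) ≠ 0 := by exact_mod_cast hn.ne'
    field_simp

/-! ### The log-likelihood ratio under a bounded density ratio. -/

section
variable {μ π : Measure ℝ} [IsProbabilityMeasure μ] [IsProbabilityMeasure π] {K₁ K₂ : ℝ}

theorem BoundedDensityRatio.lower_le_one (hK : BoundedDensityRatio μ π K₁ K₂) : K₁ ≤ 1 := by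
  have h : ENNReal.ofReal K₁ ≤ 1 := calc
    ENNReal.ofReal K₁ = ∫⁻ _, ENNReal.ofReal K₁ ∂π := by simp
    _ ≤ ∫⁻ x, μ.rnDeriv π x ∂π := lintegral_mono_ae hK.lower
    _ = 1 := by rw [Measure.lintegral_rnDeriv hK.absolutelyContinuous, measure_univ]
  simpa using h

theorem BoundedDensityRatio.one_le_upper (hK : BoundedDensityRatio μ π K₁ K₂) : 1 ≤ K₂ := by
  have h : 1 ≤ ENNReal.ofReal K₂ := calc
    1 = ∫⁻ x, μ.rnDeriv π x ∂π := by
      rw [Measure.lintegral_rnDeriv hK.absolutelyContinuous, measure_univ]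
    _ ≤ ∫⁻ _, ENNReal.ofReal K₂ ∂π := lintegral_mono_ae hK.upper
    _ = ENNReal.ofReal K₂ := by simp
  simpa using h

theorem BoundedDensityRatio.ae_toReal_mem_Icc (hK : BoundedDensityRatio μ π K₁ K₂) :
    ∀ᵐ x ∂π, (μ.rnDeriv π x).toReal ∈ Set.Icc K₁ K₂ := by
  filter_upwards [hK.lower, hK.upper] with x h1 h2
  have hne : μ.rnDeriv π x ≠ ⊤ := ne_top_of_le_ne_top ENNReal.ofReal_ne_top h2
  refine ⟨(ENNReal.ofReal_le_iff_le_toReal hne).1 h1, ?_⟩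
  exact ENNReal.toReal_le_of_le_ofReal (zero_le_one.trans hK.one_le_upper) h2

theorem BoundedDensityRatio.ae_llr_mem_Icc (hK : BoundedDensityRatio μ π K₁ K₂) :
    ∀ᵐ x ∂π, llr μ π x ∈ Set.Icc (Real.log K₁) (Real.log K₂) := by
  filter_upwards [hK.ae_toReal_mem_Icc] with x hx
  have hK1 := hK.pos
  exact ⟨Real.log_le_log hK1 hx.1, Real.log_le_log (hK1.trans_le hx.1) hx.2⟩

theorem BoundedDensityRatio.integrable_llr (hK : BoundedDensityRatio μ π K₁ K₂) :
    Integrable (llr μ π) μ :=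
  Integrable.of_mem_Icc _ _ (measurable_llr μ π).aemeasurable
    (hK.absolutelyContinuous.ae_le hK.ae_llr_mem_Icc)

theorem BoundedDensityRatio.klDiv_eq (hK : BoundedDensityRatio μ π K₁ K₂) :
    InformationTheory.klDiv μ π = ENNReal.ofReal (∫ x, llr μ π x ∂μ) := by
  rw [InformationTheory.klDiv_of_ac_of_integrable hK.absolutelyContinuous hK.integrable_llr]
  simp

theorem BoundedDensityRatio.integral_llr_pos (hK : BoundedDensityRatio μ π K₁ K₂) (hne : μ ≠ π) :
    0 < ∫ x, llr μ π x ∂μ := by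
  by_contra h
  apply hne
  rw [← InformationTheory.klDiv_eq_zero_iff, hK.klDiv_eq, ENNReal.ofReal_eq_zero]
  exact not_lt.1 h

theorem BoundedDensityRatio.integral_llr_le (hK : BoundedDensityRatio μ π K₁ K₂) :
    ∫ x, llr μ π x ∂μ ≤ Real.log K₂ - Real.log K₁ := by
  have h1 : ∫ x, llr μ π x ∂μ ≤ ∫ _, Real.log K₂ ∂μ :=
    integral_mono_ae hK.integrable_llr (integrable_const _)
      (hK.absolutelyContinuous.ae_le (hK.ae_llr_mem_Icc.mono fun x hx => hx.2))
  have h2 := Real.log_nonpos hK.pos.le hK.lower_le_one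
  simp only [integral_const, probReal_univ, smul_eq_mul, one_mul] at h1
  linarith

/-- The tangent of `exp` at `u` lies below its graph, so no bound on `v` is needed. -/
theorem exp_sub_exp_le {u v b : ℝ} (hu : u ≤ b) :
    Real.exp u - Real.exp v ≤ Real.exp b * |v - u| := by
  have h1 := Real.add_one_le_exp (v - u)
  have h2 : Real.exp v = Real.exp u * Real.exp (v - u) := by rw [← Real.exp_add]; ring_nf
  have h3 := Real.exp_le_exp.2 hu
  have h4 : Real.exp u - Real.exp v ≤ Real.exp u * |v - u| := by
    rw [h2]
    nlinarith [neg_abs_le (v - u), Real.exp_pos u]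
  exact h4.trans (mul_le_mul_of_nonneg_right h3 (abs_nonneg _))

theorem abs_sub_max_min_le {a b u v : ℝ} (hu : u ∈ Set.Icc a b) :
    |u - max a (min b v)| ≤ |u - v| := by
  obtain ⟨h1, h2⟩ := hu
  rcases max_cases a (min b v) with ⟨h, h'⟩ | ⟨h, h'⟩ <;>
  rcases min_cases b v with ⟨k, k'⟩ | ⟨k, k'⟩ <;>
  rw [h] <;> (try rw [k]) <;> (try rw [k] at h') <;>
  rw [abs_le] <;> constructor <;>
  linarith [le_abs_self (u - v), neg_abs_le (u - v), abs_nonneg (u - v)]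

/-- The log-likelihood ratio is approximated by continuous functions with compact support. -/
theorem BoundedDensityRatio.exists_continuous_approx (hK : BoundedDensityRatio μ π K₁ K₂) {η : ℝ}
    (hη : 0 < η) :
    ∃ G : ℝ → ℝ, Continuous G ∧ HasCompactSupport G ∧
      (∀ x, G x ∈ Set.Icc (Real.log K₁) (Real.log K₂)) ∧
      ∫ x, llr μ π x ∂μ - η ≤ ∫ x, G x ∂μ ∧ ∫ x, Real.exp (G x) ∂π ≤ 1 + η := by
  have hK2 : 0 < K₂ := zero_lt_one.trans_le hK.one_le_upper
  have ha := Real.log_nonpos hK.pos.le hK.lower_le_one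
  have hb := Real.log_nonneg hK.one_le_upper
  have hint : Integrable (llr μ π) π :=
    Integrable.of_mem_Icc _ _ (measurable_llr μ π).aemeasurable hK.ae_llr_mem_Icc
  -- Both uses of this error in `L¹(π)` cost a factor `K₂`: passing to `μ`, and applying `exp` below
  -- `log K₂`.
  obtain ⟨g, hgc, hgi, hg, hgint⟩ := hint.exists_hasCompactSupport_integral_sub_le
    (ε := η / K₂) (by positivity)
  set a := Real.log K₁
  set b := Real.log K₂ with hbdef
  set G : ℝ → ℝ := fun x => max a (min b (g x)) with hGdef
  have hG : Continuous G := continuous_const.max (continuous_const.min hg)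
  have hGab : ∀ x, G x ∈ Set.Icc a b := fun x =>
    ⟨le_max_left _ _, max_le (ha.trans hb) (min_le_left _ _)⟩
  have hGπ : Integrable G π :=
    Integrable.of_mem_Icc a b hG.measurable.aemeasurable (Eventually.of_forall hGab)
  have hGμ : Integrable G μ :=
    Integrable.of_mem_Icc a b hG.measurable.aemeasurable (Eventually.of_forall hGab)
  have happrox : ∫ x, |llr μ π x - G x| ∂π ≤ η / K₂ := by
    refine le_trans (integral_mono_ae (hint.sub hGπ).abs (hint.sub hgint).norm ?_) hgi
    filter_upwards [hK.ae_llr_mem_Icc] with x hx using abs_sub_max_min_le hx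
  have hK2η : K₂ * (η / K₂) = η := mul_div_cancel₀ _ hK2.ne'
  -- Clipping fixes 0, because `K₁ ≤ 1 ≤ K₂`, and so preserves compact support.
  refine ⟨G, hG, hgc.comp_left (g := fun u => max a (min b u)) (by simp [ha, hb]), hGab, ?_, ?_⟩
  · have h1 : ∫ x, llr μ π x ∂μ - ∫ x, G x ∂μ ≤ ∫ x, |llr μ π x - G x| ∂μ := by
      rw [← integral_sub hK.integrable_llr hGμ]
      exact integral_mono (hK.integrable_llr.sub hGμ) (hK.integrable_llr.sub hGμ).abs
        fun x => le_abs_self _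
    have h2 : ∫ x, |llr μ π x - G x| ∂μ ≤ K₂ * ∫ x, |llr μ π x - G x| ∂π := by
      rw [← integral_rnDeriv_smul hK.absolutelyContinuous, ← integral_const_mul]
      refine integral_mono_ae ?_ ((hint.sub hGπ).abs.const_mul _) ?_
      · exact (integrable_rnDeriv_smul_iff hK.absolutelyContinuous).2
          (hK.integrable_llr.sub hGμ).abs
      · filter_upwards [hK.ae_toReal_mem_Icc] with x hx
        exact mul_le_mul_of_nonneg_right hx.2 (abs_nonneg _)
    have h3 := mul_le_mul_of_nonneg_left happrox hK2.le
    linarith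
  · have hexp : ∫ x, Real.exp (llr μ π x) ∂π = 1 := by
      have : (fun x => Real.exp (llr μ π x)) =ᵐ[π] fun x => (μ.rnDeriv π x).toReal := by
        filter_upwards [hK.ae_toReal_mem_Icc] with x hx
        rw [llr_def]
        exact Real.exp_log (hK.pos.trans_le hx.1)
      rw [integral_congr_ae this, Measure.integral_toReal_rnDeriv hK.absolutelyContinuous,
        probReal_univ]
    have hi1 : Integrable (fun x => Real.exp (llr μ π x)) π := by
      refine Integrable.of_mem_Icc (Real.exp a) (Real.exp b)
        (Real.measurable_exp.comp (measurable_llr μ π)).aemeasurable ?_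
      filter_upwards [hK.ae_llr_mem_Icc] with x hx
      exact ⟨Real.exp_le_exp.2 hx.1, Real.exp_le_exp.2 hx.2⟩
    have hi2 : Integrable (fun x => Real.exp (G x)) π :=
      Integrable.of_mem_Icc (Real.exp a) (Real.exp b)
        (Real.measurable_exp.comp hG.measurable).aemeasurable
        (Eventually.of_forall fun x =>
          ⟨Real.exp_le_exp.2 (hGab x).1, Real.exp_le_exp.2 (hGab x).2⟩)
    have h1 : ∫ x, Real.exp (G x) ∂π - ∫ x, Real.exp (llr μ π x) ∂π
        ≤ K₂ * ∫ x, |llr μ π x - G x| ∂π := by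
      rw [← integral_sub hi2 hi1, ← integral_const_mul]
      refine integral_mono (hi2.sub hi1) ((hint.sub hGπ).abs.const_mul _) fun x => ?_
      have := exp_sub_exp_le (v := llr μ π x) (hGab x).2
      rwa [hbdef, Real.exp_log hK2] at this
    have h3 := mul_le_mul_of_nonneg_left happrox hK2.le
    linarith

end

/-! ### Asymptotics of the two tail bounds. -/

/-- The coefficient is read off from one term of the binomial expansion of `(1 / l + 1) ^ n`. The
rate tends to 0 as `l` grows, so the choice of end points is free on the exponential scale. -/
theorem choose_le_exp {n l k : ℕ} (hl : 0 < l) (hk : k ≤ n / l) :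
    (n.choose k : ℝ) ≤ Real.exp (n * ((1 + Real.log l) / l)) := by
  have hl' : (0 : ℝ) < l := by exact_mod_cast hl
  have hl1 : (1 : ℝ) ≤ l := by exact_mod_cast hl
  have hkn : k ≤ n := hk.trans (Nat.div_le_self _ _)
  have h1 : (1 / (l : ℝ)) ^ k * n.choose k ≤ (1 / (l : ℝ) + 1) ^ n := by
    rw [add_pow]
    have := Finset.single_le_sum (f := fun m => (1 / (l : ℝ)) ^ m * 1 ^ (n - m) * (n.choose m : ℝ))
      (s := Finset.range (n + 1)) (fun m _ => by positivity) (Finset.mem_range.2 (by omega : k < n + 1))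
    simpa using this
  have h2 : (1 / (l : ℝ) + 1) ^ n ≤ Real.exp (n * (1 / (l : ℝ))) := by
    rw [Real.exp_nat_mul]
    exact pow_le_pow_left₀ (by positivity) (Real.add_one_le_exp _) n
  have h3 : (l : ℝ) ^ k ≤ Real.exp (n * (Real.log l / l)) := by
    rw [← Real.exp_log (pow_pos hl' k), Real.log_pow]
    refine Real.exp_le_exp.2 ?_
    have hkr : (k : ℝ) * l ≤ n := by
      exact_mod_cast (Nat.mul_le_mul_right l hk).trans (Nat.div_mul_le_self n l)
    have : (k : ℝ) ≤ n / l := (le_div_iff₀ hl').2 hkr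
    calc (k : ℝ) * Real.log l ≤ n / l * Real.log l :=
          mul_le_mul_of_nonneg_right this (Real.log_nonneg hl1)
      _ = _ := by ring
  calc (n.choose k : ℝ) = (l : ℝ) ^ k * ((1 / (l : ℝ)) ^ k * n.choose k) := by
        rw [← mul_assoc, ← mul_pow, mul_one_div_cancel hl'.ne', one_pow, one_mul]
    _ ≤ Real.exp (n * (Real.log l / l)) * Real.exp (n * (1 / (l : ℝ))) :=
        mul_le_mul h3 (h1.trans h2) (by positivity) (Real.exp_pos _).le
    _ = _ := by rw [← Real.exp_add]; congr 1; ring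

theorem eventually_pos_and_le {l : ℕ → ℕ} (hl : Tendsto l atTop atTop)
    (hT : Tendsto (fun n => n / l n) atTop atTop) : ∀ᶠ n in atTop, 0 < l n ∧ l n ≤ n := by
  filter_upwards [hl.eventually_gt_atTop 0, hT.eventually_gt_atTop 0] with n h1 h2
  exact ⟨h1, (Nat.div_pos_iff.1 h2).2⟩

theorem tendsto_segmentSize_div {l : ℕ → ℕ} (hl : Tendsto l atTop atTop)
    (hT : Tendsto (fun n => n / l n) atTop atTop) :
    Tendsto (fun n => (l n : ℝ) / n) atTop (nhds 0) := by
  have h1 : Tendsto (fun n => 1 / ((n / l n : ℕ) : ℝ)) atTop (nhds 0) :=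
    tendsto_one_div_atTop_nhds_zero_nat.comp hT
  refine tendsto_of_tendsto_of_tendsto_of_le_of_le' tendsto_const_nhds h1
    (Eventually.of_forall fun n => by positivity) ?_
  filter_upwards [eventually_pos_and_le hl hT] with n hn
  have hT0 : (0 : ℝ) < (n / l n : ℕ) := by exact_mod_cast Nat.div_pos hn.2 hn.1
  have hn0 : (0 : ℝ) < n := by exact_mod_cast hn.1.trans_le hn.2
  rw [div_le_div_iff₀ hn0 hT0, one_mul]
  exact_mod_cast Nat.mul_div_le n (l n)

theorem tendsto_log_nat_div : Tendsto (fun n : ℕ => Real.log n / n) atTop (nhds 0) := by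
  have h := (Real.isLittleO_log_id_atTop.tendsto_div_nhds_zero).comp
    (tendsto_natCast_atTop_atTop (R := ℝ))
  simpa [Function.comp_def] using h

theorem eventually_measure_le_klEstimator_le {π : Measure ℝ} [IsProbabilityMeasure π]
    [NullSingletonClass π] {l : ℕ → ℕ} (hl : Tendsto l atTop atTop)
    (hT : Tendsto (fun n => n / l n) atTop atTop) {A c : ℝ} (hA : A < c) :
    ∀ᶠ n in atTop, (Measure.pi fun _ : Fin n => π) {y | c ≤ klEstimator π (l n) y} ≤
      ENNReal.ofReal (Real.exp (-(n * A))) := by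
  have hlim : Tendsto (fun n : ℕ => ((1 + c) * (1 / (l n : ℝ)) + Real.log (l n) / l n)
      + 2 * (Real.log n / n)) atTop (nhds (((1 + c) * 0 + 0) + 2 * 0)) :=
    (((tendsto_one_div_atTop_nhds_zero_nat.comp hl).const_mul _).add
      (tendsto_log_nat_div.comp hl)).add (tendsto_log_nat_div.const_mul 2)
  simp only [mul_zero, add_zero] at hlim
  filter_upwards [hlim.eventually_lt_const (sub_pos.2 hA), eventually_pos_and_le hl hT]
    with n h1 hn
  have hn0 : (0 : ℝ) < n := by exact_mod_cast hn.1.trans_le hn.2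
  have hl0 : (0 : ℝ) < l n := by exact_mod_cast hn.1
  refine (measure_le_klEstimator_le hn.1 hn.2 c).trans (ENNReal.ofReal_le_ofReal ?_)
  refine (mul_le_mul_of_nonneg_right (choose_le_exp hn.1 (Nat.sub_le _ 1))
    (Real.exp_pos _).le).trans ?_
  rw [← Real.exp_add]
  refine Real.exp_le_exp.2 ?_
  have h2 := mul_le_mul_of_nonneg_left h1.le hn0.le
  have h3 : n * (((1 + c) * (1 / (l n : ℝ)) + Real.log (l n) / l n) + 2 * (Real.log n / n))
      = n * ((1 + Real.log (l n)) / l n) + n * c / l n + 2 * Real.log n := by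
    field_simp
    ring
  rw [h3] at h2
  have h4 : (1 - 1 / (l n : ℝ)) * (n * c) = n * c - n * c / l n := by ring
  rw [h4]
  linarith

theorem eventually_measure_klEstimator_le_le {μ π : Measure ℝ} [IsProbabilityMeasure μ]
    [IsProbabilityMeasure π] [NullSingletonClass π] {K₁ K₂ : ℝ}
    (hK : BoundedDensityRatio μ π K₁ K₂) (hne : μ ≠ π) {l : ℕ → ℕ} (hl : Tendsto l atTop atTop)
    (hT : Tendsto (fun n => n / l n) atTop atTop) :
    ∀ᶠ n in atTop, (Measure.pi fun _ : Fin n => μ)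
      {y | klEstimator π (l n) y ≤ (∫ x, llr μ π x ∂μ) / 2} ≤
      ENNReal.ofReal (Real.exp (-(n * ((∫ x, llr μ π x ∂μ) ^ 2 /
        (8 * (Real.log K₂ - Real.log K₁) ^ 2))))) := by
  have hD := hK.integral_llr_pos hne
  set D := ∫ x, llr μ π x ∂μ with hDdef
  have hnull : NullSingletonClass μ :=
    ⟨fun x => hK.absolutelyContinuous (measure_singleton x)⟩
  -- Four losses of `D / 32` (mean of `G`, exponential moment, oscillation, breakpoint cells) total
  -- `D / 8`. The gap `D / 2` thus leaves room for a deviation `D / 4`, and Hoeffding gives `2 (D /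
  -- 4)² / L²`.
  obtain ⟨G, hG, hGc, hGab, hGμ, hGπ⟩ := hK.exists_continuous_approx (η := D / 32) (by positivity)
  rw [← hDdef] at hGμ
  obtain ⟨B, hB⟩ := exists_breakpoints hG hGc (ε := D / 32) (by positivity)
  set L := Real.log K₂ - Real.log K₁ with hL
  have hlim : Tendsto (fun n : ℕ => (B.card * 2 * L) * ((l n : ℝ) / n)) atTop
      (nhds ((B.card * 2 * L) * 0)) := (tendsto_segmentSize_div hl hT).const_mul _
  rw [mul_zero] at hlim
  filter_upwards [hlim.eventually_lt_const (show 0 < D / 32 by positivity),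
    eventually_pos_and_le hl hT] with n h1 hn
  have hn0 : (0 : ℝ) < n := by exact_mod_cast hn.1.trans_le hn.2
  have h := measure_sum_le_le (n := n) (ρ := μ) hG.measurable hGab (s := D / 4) (by positivity)
  refine le_trans (measure_mono_ae ?_) (h.trans (ENNReal.ofReal_le_ofReal (Real.exp_le_exp.2 ?_)))
  · filter_upwards [ae_isGenericSample (ι := Fin n) hK.absolutelyContinuous] with y hy hyD
    have h2 := klEstimator_ge hy hn.1 hn.2 hG.measurable hGab (by positivity) hB
    have h3 : B.card * (2 * (l n : ℝ) / n) * (Real.log K₂ - Real.log K₁)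
        = (B.card * 2 * L) * ((l n : ℝ) / n) := by rw [hL]; ring
    rw [h3] at h2
    have h4 : (∑ i, G (y i)) / n ≤ ∫ x, G x ∂μ - D / 4 := by
      have : klEstimator π (l n) y ≤ D / 2 := hyD
      linarith
    change ∑ i, G (y i) ≤ n * (∫ x, G x ∂μ - D / 4)
    rw [div_le_iff₀ hn0] at h4
    linarith
  · refine le_of_eq ?_
    have hL0 : 0 < L := hD.trans_le hK.integral_llr_le
    rw [← hL]
    field_simp
    norm_num

/-! ### From tail bounds to the error exponent. -/

theorem BoundedDensityRatio.ratio_mul_log_lt_one {μ π : Measure ℝ} {K₁ K₂ : ℝ}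
    (hK : BoundedDensityRatio μ π K₁ K₂) (h2 : 0 < K₂) :
    K₁ / (K₁ + K₂) * (Real.log K₂ - Real.log K₁) < 1 := by
  have h1 := hK.pos
  rw [← Real.log_div h2.ne' h1.ne', div_mul_eq_mul_div, div_lt_one (by positivity)]
  have h := mul_le_mul_of_nonneg_left (Real.log_le_sub_one_of_pos (div_pos h2 h1)) h1.le
  have h3 : K₁ * (K₂ / K₁ - 1) = K₂ - K₁ := by field_simp
  rw [h3] at h
  linarith

/-- Passing to a measurable hull of `S` avoids proving that the estimator is measurable. -/
theorem jointLaw_eval_preimage_le {M n : ℕ} (μ π : Measure ℝ) [IsProbabilityMeasure μ]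
    [IsProbabilityMeasure π] (i j : Fin M) (S : Set (Fin n → ℝ)) :
    jointLaw n μ π i {y | y j ∈ S} ≤ (Measure.pi fun _ : Fin n => if j = i then μ else π) S := by
  have hprob : ∀ j : Fin M, IsProbabilityMeasure (if j = i then μ else π) := by
    intro j
    split_ifs <;> infer_instance
  have h := measurePreserving_eval
    (fun j : Fin M => Measure.pi fun _ : Fin n => if j = i then μ else π) j
  rw [← measure_toMeasurable S,
    ← h.measure_preimage (measurableSet_toMeasurable _ _).nullMeasurableSet]
  exact measure_mono fun y hy => subset_toMeasurable _ _ hy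

theorem maxError_le {M n : ℕ} {π μ : Measure ℝ} [IsProbabilityMeasure μ] [IsProbabilityMeasure π]
    {l : ℕ} {δ : (Fin M → Fin n → ℝ) → Fin M}
    (hδ : ∀ (y : Fin M → Fin n → ℝ) (j : Fin M), klEstimator π l (y j) ≤ klEstimator π l (y (δ y)))
    (c : ℝ) {e : ℝ≥0∞}
    (h1 : (Measure.pi fun _ : Fin n => π) {y | c ≤ klEstimator π l y} ≤ e)
    (h2 : (Measure.pi fun _ : Fin n => μ) {y | klEstimator π l y ≤ c} ≤ e) :
    maxError δ π μ ≤ (M + 1) * e := by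
  refine iSup_le fun i => ?_
  have hsub : {y : Fin M → Fin n → ℝ | δ y ≠ i} ⊆
      (⋃ j ∈ Finset.univ.filter (· ≠ i), {y | y j ∈ {z | c ≤ klEstimator π l z}}) ∪
        {y | y i ∈ {z | klEstimator π l z ≤ c}} := by
    intro y hy
    by_cases hc : klEstimator π l (y i) ≤ c
    · exact Or.inr hc
    · refine Or.inl (Set.mem_biUnion (x := δ y) (by simpa using hy) ?_)
      exact (not_le.1 hc).le.trans (hδ y i)
  refine (measure_mono hsub).trans ((measure_union_le _ _).trans ?_)
  rw [add_mul, one_mul]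
  refine add_le_add ?_ ?_
  · refine (measure_biUnion_finset_le _ _).trans ((Finset.sum_le_card_nsmul _ _ e ?_).trans ?_)
    · intro j hj
      refine (jointLaw_eval_preimage_le μ π i j _).trans ?_
      rw [if_neg (Finset.mem_filter.1 hj).2]
      exact h1
    · rw [nsmul_eq_mul]
      gcongr
      exact (Finset.card_filter_le _ _).trans (by simp)
  · refine (jointLaw_eval_preimage_le μ π i i _).trans ?_
    rw [if_pos rfl]
    exact h2

/-- The strict gap `A - θ` absorbs the constant `C` for large `n`. -/
theorem le_errorExponent {M : ℕ} {δ : (n : ℕ) → (Fin M → Fin n → ℝ) → Fin M} {π μ : Measure ℝ}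
    {C A θ : ℝ} (hC : 0 ≤ C) (hθ : θ < A)
    (h : ∀ᶠ n : ℕ in atTop, maxError (δ n) π μ ≤
      ENNReal.ofReal C * ENNReal.ofReal (Real.exp (-(n * A)))) :
    (θ : EReal) ≤ errorExponent δ π μ := by
  have hlim : Tendsto (fun n : ℕ => Real.exp (n * (A - θ))) atTop atTop :=
    Real.tendsto_exp_atTop.comp
      (tendsto_natCast_atTop_atTop.atTop_mul_const (sub_pos.2 hθ))
  refine le_liminf_of_le (by isBoundedDefault) ?_
  filter_upwards [h, hlim.eventually_ge_atTop C, eventually_gt_atTop 0] with n hn hCn hn0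
  have hn0' : (0 : EReal) < n := by exact_mod_cast hn0
  rw [EReal.le_div_iff_mul_le hn0' (EReal.natCast_ne_top n)]
  have h1 : maxError (δ n) π μ ≤ ENNReal.ofReal (Real.exp (-(n * θ))) := by
    refine hn.trans ?_
    rw [← ENNReal.ofReal_mul hC]
    refine ENNReal.ofReal_le_ofReal ((mul_le_mul_of_nonneg_right hCn (Real.exp_pos _).le).trans ?_)
    rw [← Real.exp_add]
    exact Real.exp_le_exp.2 (le_of_eq (by ring))
  have h2 := ENNReal.log_monotone h1
  rw [ENNReal.log_ofReal, if_neg (not_le.2 (Real.exp_pos _)), Real.log_exp] at h2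
  rw [EReal.le_neg]
  refine h2.trans (le_of_eq ?_)
  rw [EReal.coe_neg, EReal.coe_mul, mul_comm]
  rfl

end OutlierDetection

theorem theorem3 {M : ℕ} (π : Measure ℝ) [IsProbabilityMeasure π] [NullSingletonClass π]
    (l : ℕ → ℕ) (hl : Tendsto l atTop atTop) (hT : Tendsto (fun n => n / l n) atTop atTop)
    (δ : (n : ℕ) → (Fin M → Fin n → ℝ) → Fin M) (hδ : OutlierDetection.IsKLTest π l δ)
    (μ : Measure ℝ) [IsProbabilityMeasure μ] (hne : μ ≠ π)
    (K₁ K₂ : ℝ) (hK : OutlierDetection.BoundedDensityRatio μ π K₁ K₂) :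
    OutlierDetection.ExponentiallyConsistent δ π μ ∧
      ((ENNReal.ofReal (1 / 32 * (K₁ / (K₁ + K₂)) ^ 2) *
          (InformationTheory.klDiv μ π) ^ 2 : ℝ≥0∞) : EReal) ≤
        OutlierDetection.errorExponent δ π μ := by
  have hK1 := hK.pos
  have hK2 : 0 < K₂ := zero_lt_one.trans_le hK.one_le_upper
  have hD := hK.integral_llr_pos hne
  have hDL := hK.integral_llr_le
  have hκL := hK.ratio_mul_log_lt_one hK2
  have hI := OutlierDetection.eventually_measure_klEstimator_le_le hK hne hl hT
  rw [hK.klDiv_eq]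
  set D := ∫ x, llr μ π x ∂μ with hDdef
  set L := Real.log K₂ - Real.log K₁ with hL
  set κ := K₁ / (K₁ + K₂) with hκ
  have hκ0 : 0 < κ := by positivity
  have hκ1 : κ ≤ 1 := (div_le_one (by positivity)).2 (by linarith)
  have hL0 : 0 < L := hD.trans_le hDL
  set θ := 1 / 32 * κ ^ 2 * D ^ 2 with hθ
  have hθ0 : 0 < θ := by positivity
  have hκD : κ * D < 1 := lt_of_le_of_lt (mul_le_mul_of_nonneg_left hDL hκ0.le) hκL
  -- `κ * D < 1` and `κ ≤ 1` make the quadratic rate at most linear in `D`.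
  have hθD : θ < D / 2 := by
    have h1 : κ * D * (κ * D) ≤ 1 * D :=
      mul_le_mul hκD.le (by nlinarith) (by positivity) zero_le_one
    have h2 : θ = 1 / 32 * (κ * D * (κ * D)) := by rw [hθ]; ring
    linarith
  -- After clearing denominators this is `(κ * L) ^ 2 / 4 < 1`.
  have hθL : θ < D ^ 2 / (8 * L ^ 2) := by
    rw [lt_div_iff₀ (by positivity)]
    have h1 : (κ * L) ^ 2 ≤ 1 := pow_le_one₀ (by positivity) hκL.le
    have h2 : θ * (8 * L ^ 2) = 1 / 4 * (κ * L) ^ 2 * D ^ 2 := by rw [hθ]; ring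
    have h3 : 0 < D ^ 2 := by positivity
    rw [h2]
    nlinarith
  have hexp : (θ : EReal) ≤ OutlierDetection.errorExponent δ π μ := by
    obtain ⟨A, hA, hAmin⟩ := exists_between (lt_min hθD hθL)
    have hAD := hAmin.trans_le (min_le_left _ _)
    have hAL := hAmin.trans_le (min_le_right _ _)
    refine OutlierDetection.le_errorExponent (C := M + 1) (by positivity) hA ?_
    filter_upwards [OutlierDetection.eventually_measure_le_klEstimator_le (π := π) hl hT hAD, hI]
      with n h1 h2
    have h3 := OutlierDetection.maxError_le (hδ n) (D / 2) h1
      (h2.trans (ENNReal.ofReal_le_ofReal (Real.exp_le_exp.2 (neg_le_neg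
        (mul_le_mul_of_nonneg_left hAL.le (Nat.cast_nonneg n))))))
    refine h3.trans (le_of_eq ?_)
    congr 1
    rw [ENNReal.ofReal_add (by positivity) zero_le_one, ENNReal.ofReal_natCast, ENNReal.ofReal_one]
  refine ⟨lt_of_lt_of_le (by exact_mod_cast hθ0) hexp, le_of_eq_of_le ?_ hexp⟩
  rw [← ENNReal.ofReal_pow hD.le, ← ENNReal.ofReal_mul (by positivity), EReal.coe_ennreal_ofReal,
    max_eq_left hθ0.le]
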